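/- Let $n\ge 0$ and $k\ge 1$ be integers. Let $J_k\mathbb{C}^n=\mathrm{Hom}(\mathbb{C}^k,\mathbb{C}^n)$ be the affine space of $k$-jets $(f'(0),f''(0)/2!,\dots,f^{(k)}(0)/k!)$ of holomorphic curves $f:(\mathbb{C},0)\to(\mathbb{C}^n,0)$, and let $G_k\subset GL_k(\mathbb{C})$ be the group of $k$-jets of reparametrizations $\varphi(t)=a_1t+a_2t^2+\dots+a_kt^k$, $a_1\neq 0$, realized by the matrices whose $(i,j)$ entry is the coefficient of $t^j$ in $\varphi(t)^i$ and acting on $J_k\mathbb{C}^n$ by right multiplication. Let $Q=J_k\mathbb{C}^n/G_k$ be the orbit space, with the quotient of the Zariski topology and the structure sheaf $\mathcal{O}_Q$ whose sections over an open $U$ are the functions on $U$ with regular pullback to the preimage of $U$, that is, the $G_k$-invariant regular functions on that preimage. Let $\widetilde Q\to Q$ be the normalization: its points over $q\in Q$ are the maximal ideals of the integral closure of $\mathcal{O}_{Q,q}$ in the function field $K$ of $Q$, and the local ring at such a point is the localization of this integral closure at that ideal; $\mathbb{C}[\widetilde Q]\subset K$ is the intersection of these local rings over all points of $\widetilde Q$.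 Then: 1. The coordinate ring $\mathbb{C}[\widetilde Q]$ is a finitely generated $\mathbb{C}$-algebra. 2. The stalk of $\mathcal{O}_Q$ at every regular point is finitely generated as a local ring (essentially of finite type over $\mathbb{C}$): if $f\in J_k\mathbb{C}^n$ is regular, i.e. $f'(0)\ne 0$, and $q\in Q$ is its orbit, then there is an open neighbourhood $U$ of $q$ in $Q$ such that $\mathcal{O}_Q(U)$ is a finitely generated $\mathbb{C}$-algebra and the stalk $\mathcal{O}_{Q,q}$ is, via the germ map, the localization of $\mathcal{O}_Q(U)$ at the prime ideal of the functions vanishing at $q$. -/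

import Mathlib

namespace InvJet

open Polynomial TopologicalSpace

/-! ### Jets, the reparametrization group, and its action -/

/-- `k`-jets at `0` of holomorphic curves `f : (ℂ, 0) → (ℂⁿ, 0)`, i.e. `J_k ℂⁿ = Hom(ℂᵏ, ℂⁿ)`:
the column of index `j` (counted from `0`) is the Taylor coefficient `f^{(j+1)}(0) / (j+1)!`. -/
abbrev Jet (n k : ℕ) : Type := Matrix (Fin n) (Fin k) ℂ

/-- A jet is regular if `f'(0) ≠ 0`. -/
def Jet.IsRegular {n k : ℕ} (x : Jet n k) : Prop :=
  ∃ (i : Fin n) (j : Fin k), j.val = 0 ∧ x i j ≠ 0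

/-- The matrix of the substitution `t ↦ φ(t)` modulo `t^(k+1)`: its `(i, j)` entry, for
`1 ≤ i, j ≤ k`, is the coefficient of `t^j` in `φ(t)^i`. For `φ = a₁ t + ⋯ + a_k t^k + ⋯` this is
`∑_{s₁ + ⋯ + s_i = j} a_{s₁} ⋯ a_{s_i}`; only `a₁, …, a_k` matter. -/
noncomputable def substMatrix (k : ℕ) (φ : ℂ[X]) : Matrix (Fin k) (Fin k) ℂ :=
  Matrix.of fun i j => (φ ^ (i.val + 1)).coeff (j.val + 1)

theorem coeff_comp_eq_sum (k : ℕ) (p q : ℂ[X]) (hp : p.coeff 0 = 0) (hq : q.coeff 0 = 0)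
    (m : Fin k) :
    (p.comp q).coeff (m.val + 1)
      = ∑ j : Fin k, p.coeff (j.val + 1) * (q ^ (j.val + 1)).coeff (m.val + 1) := by
  have hX : X ∣ q := X_dvd_iff.mpr hq
  have hvan : ∀ j : ℕ, m.val + 1 < j → (q ^ j).coeff (m.val + 1) = 0 := by
    intro j hj
    obtain ⟨r, hr⟩ := pow_dvd_pow_of_dvd hX j
    rw [hr, coeff_X_pow_mul']
    simp [hj]
  set N := max (p.natDegree + 1) (k + 1) with hN
  have h1 : p.comp q = ∑ j ∈ Finset.range N, C (p.coeff j) * q ^ j := by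
    rw [comp, eval₂_eq_sum_range' C (lt_of_lt_of_le (Nat.lt_succ_self _) (le_max_left _ _))]
  rw [h1, finsetSum_coeff]
  simp only [coeff_C_mul]
  have h2 : ∑ j ∈ Finset.range N, p.coeff j * (q ^ j).coeff (m.val + 1)
      = ∑ j ∈ Finset.range (k + 1), p.coeff j * (q ^ j).coeff (m.val + 1) := by
    symm
    apply Finset.sum_subset
    · intro j hj
      rw [Finset.mem_range] at hj ⊢
      exact lt_of_lt_of_le hj (le_max_right _ _)
    · intro j _ hj
      rw [Finset.mem_range, not_lt] at hj
      rw [hvan j (by have := m.isLt; omega), mul_zero]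
  rw [h2, Finset.sum_range_succ', hp, zero_mul, add_zero, Finset.sum_range]

theorem substMatrix_mul (k : ℕ) (p q : ℂ[X]) (hp : p.coeff 0 = 0) (hq : q.coeff 0 = 0) :
    substMatrix k p * substMatrix k q = substMatrix k (p.comp q) := by
  ext i m
  have h := coeff_comp_eq_sum k (p ^ (i.val + 1)) q
    (by rw [coeff_zero_eq_eval_zero] at hp ⊢; simp [hp]) hq m
  simp only [Matrix.mul_apply, substMatrix, Matrix.of_apply]
  rw [← h, pow_comp]

theorem substMatrix_X (k : ℕ) : substMatrix k X = 1 := by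
  ext i j
  simp [substMatrix, coeff_X_pow, Matrix.one_apply, Fin.ext_iff, eq_comm]

theorem substMatrix_congr (k : ℕ) (p q : ℂ[X]) (h : ∀ j ≤ k, p.coeff j = q.coeff j) :
    substMatrix k p = substMatrix k q := by
  have key : ∀ i j : ℕ, j ≤ k → (p ^ i).coeff j = (q ^ i).coeff j := by
    intro i
    induction i with
    | zero => intro j _; simp
    | succ i ih =>
      intro j hj
      rw [pow_succ, pow_succ, coeff_mul, coeff_mul]
      refine Finset.sum_congr rfl fun ab hab => ?_
      have := Finset.HasAntidiagonal.mem_antidiagonal.mp hab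
      rw [ih ab.1 (by omega), h ab.2 (by omega)]
  ext i j
  exact key (i.val + 1) (j.val + 1) j.isLt

theorem comp_coeff_zero (p q : ℂ[X]) (hp : p.coeff 0 = 0) (hq : q.coeff 0 = 0) :
    (p.comp q).coeff 0 = 0 := by
  rw [coeff_zero_eq_eval_zero] at *
  simp [eval_comp, hp, hq]

theorem comp_coeff_one (p q : ℂ[X]) (hp : p.coeff 0 = 0) (hq : q.coeff 0 = 0) :
    (p.comp q).coeff 1 = p.coeff 1 * q.coeff 1 := by
  have h := coeff_comp_eq_sum 1 p q hp hq 0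
  simpa using h

theorem exists_comp_inverse (k : ℕ) (p : ℂ[X]) (hp : p.coeff 0 = 0)
    (g : GL (Fin k) ℂ) (hg : (g : Matrix (Fin k) (Fin k) ℂ) = substMatrix k p) :
    ∃ q : ℂ[X], q.coeff 0 = 0 ∧ q.coeff 1 ≠ 0 ∧
      ((g⁻¹ : GL (Fin k) ℂ) : Matrix (Fin k) (Fin k) ℂ) = substMatrix k q := by
  rcases Nat.eq_zero_or_pos k with rfl | hk
  · exact ⟨X, by simp, by simp, Subsingleton.elim _ _⟩
  set B : Matrix (Fin k) (Fin k) ℂ := ((g⁻¹ : GL (Fin k) ℂ) : Matrix (Fin k) (Fin k) ℂ) with hB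
  have hBg : B * substMatrix k p = 1 := by
    rw [hB, ← hg]; exact Units.inv_mul g
  let q : ℂ[X] := ∑ j : Fin k, C (B ⟨0, hk⟩ j) * X ^ (j.val + 1)
  have hqc : ∀ j : Fin k, q.coeff (j.val + 1) = B ⟨0, hk⟩ j := by
    intro j
    simp only [q, finsetSum_coeff, coeff_C_mul, coeff_X_pow]
    rw [Finset.sum_eq_single j]
    · simp
    · intro b _ hb
      have : ¬ (j.val + 1 = b.val + 1) := fun h => hb (Fin.ext (by omega))
      rw [if_neg this, mul_zero]
    · simp
  have hq0 : q.coeff 0 = 0 := by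
    simp [q, coeff_X_pow]
  have hcomp : ∀ m : Fin k, (q.comp p).coeff (m.val + 1) = (X : ℂ[X]).coeff (m.val + 1) := by
    intro m
    rw [coeff_comp_eq_sum k q p hq0 hp m]
    have := congrFun (congrFun hBg ⟨0, hk⟩) m
    simp only [Matrix.mul_apply, substMatrix, Matrix.of_apply] at this
    simp only [hqc]
    rw [this]
    simp [Matrix.one_apply, coeff_X, Fin.ext_iff]
    simp [eq_comm]
  have hle : ∀ j ≤ k, (q.comp p).coeff j = (X : ℂ[X]).coeff j := by
    intro j hj
    cases j with
    | zero => rw [comp_coeff_zero q p hq0 hp]; simp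
    | succ j => exact hcomp ⟨j, by omega⟩
  have hmul : substMatrix k q * substMatrix k p = 1 := by
    rw [substMatrix_mul k q p hq0 hp, substMatrix_congr k _ _ hle, substMatrix_X]
  refine ⟨q, hq0, ?_, ?_⟩
  · intro h
    have h1 := hle 1 hk
    rw [comp_coeff_one q p hq0 hp, h] at h1
    simp at h1
  · rw [← hg] at hmul hBg
    have hgu : (g : Matrix (Fin k) (Fin k) ℂ) * B = 1 := Units.mul_inv g
    calc B = (substMatrix k q * (g : Matrix (Fin k) (Fin k) ℂ)) * B := by rw [hmul, one_mul]
      _ = substMatrix k q := by rw [mul_assoc, hgu, mul_one]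

/-- The group `G_k` of `k`-jets of reparametrizations `t ↦ φ(t) = a₁ t + a₂ t² + ⋯`, `a₁ ≠ 0`, of
`(ℂ, 0)`, as a subgroup of `GL_k(ℂ)`. -/
def reparamGroup (k : ℕ) : Subgroup (GL (Fin k) ℂ) where
  carrier := {g | ∃ φ : ℂ[X], φ.coeff 0 = 0 ∧ φ.coeff 1 ≠ 0 ∧
    (g : Matrix (Fin k) (Fin k) ℂ) = substMatrix k φ}
  one_mem' := ⟨X, by simp, by simp, by simp [substMatrix_X]⟩
  mul_mem' := by
    rintro g h ⟨p, hp0, hp1, hg⟩ ⟨q, hq0, hq1, hh⟩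
    refine ⟨p.comp q, comp_coeff_zero p q hp0 hq0, ?_, ?_⟩
    · rw [comp_coeff_one p q hp0 hq0]; exact mul_ne_zero hp1 hq1
    · rw [Units.val_mul, hg, hh, substMatrix_mul k p q hp0 hq0]
  inv_mem' := by
    rintro g ⟨p, hp0, hp1, hg⟩
    exact exists_comp_inverse k p hp0 g hg

/-- Two jets are equivalent if they lie in the same orbit of `G_k`, which acts on `J_k ℂⁿ` by
multiplication of matrices on the right (reparametrization of curves). -/
def orbitSetoid (n k : ℕ) : Setoid (Jet n k) where
  r x y := ∃ g ∈ reparamGroup k, x * (g : Matrix (Fin k) (Fin k) ℂ) = y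
  iseqv :=
    { refl := fun x => ⟨1, one_mem _, by simp⟩
      symm := by
        rintro x y ⟨g, hg, rfl⟩
        exact ⟨g⁻¹, inv_mem hg, by rw [Matrix.mul_assoc, Units.mul_inv, Matrix.mul_one]⟩
      trans := by
        rintro x y z ⟨g, hg, rfl⟩ ⟨h, hh, rfl⟩
        exact ⟨g * h, mul_mem hg hh, by rw [Units.val_mul, Matrix.mul_assoc]⟩ }

/-! ### The quotient `J_k ℂⁿ / G_k` and its sheaf of regular functions -/

/-- Evaluation of a polynomial in the coordinates of `J_k ℂⁿ` at a jet. -/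
noncomputable def evalJet {n k : ℕ} (x : Jet n k) :
    MvPolynomial (Fin n × Fin k) ℂ →ₐ[ℂ] ℂ :=
  MvPolynomial.aeval fun ij => x ij.1 ij.2

/-- The Zariski topology of the affine space `J_k ℂⁿ`. -/
@[reducible]
def zariski (n k : ℕ) : TopologicalSpace (Jet n k) :=
  TopologicalSpace.generateFrom
    {U | ∃ p : MvPolynomial (Fin n × Fin k) ℂ, U = {x | evalJet x p ≠ 0}}

/-- The orbit space `J_k ℂⁿ / G_k`. -/
def JetQuotient (n k : ℕ) : Type := Quotient (orbitSetoid n k)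

/-- The quotient map `J_k ℂⁿ → J_k ℂⁿ / G_k`. -/
def proj {n k : ℕ} (x : Jet n k) : JetQuotient n k := Quotient.mk (orbitSetoid n k) x

/-- The quotient of the Zariski topology. -/
instance (n k : ℕ) : TopologicalSpace (JetQuotient n k) :=
  TopologicalSpace.coinduced proj (zariski n k)

variable {n k : ℕ}

/-- The structure sheaf of `J_k ℂⁿ / G_k`: the functions on the open set `U` whose pullback to the
preimage of `U` in `J_k ℂⁿ` is regular, i.e. locally a quotient of polynomials. (Pullbacks from the
orbit space are exactly the `G_k`-invariant functions.) -/
def regularFunctions (U : Opens (JetQuotient n k)) : Subalgebra ℂ (U → ℂ) where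
  carrier := {f | ∀ x : Jet n k, proj x ∈ U → ∃ p s : MvPolynomial (Fin n × Fin k) ℂ,
    evalJet x s ≠ 0 ∧ ∀ (y : Jet n k) (hy : proj y ∈ U), evalJet y s ≠ 0 →
      f ⟨proj y, hy⟩ = evalJet y p / evalJet y s}
  mul_mem' := by
    intro f g hf hg x hx
    obtain ⟨p, s, hs, h⟩ := hf x hx
    obtain ⟨p', s', hs', h'⟩ := hg x hx
    refine ⟨p * p', s * s', by simp [hs, hs'], fun y hy hyy => ?_⟩
    simp only [map_mul, ne_eq, mul_eq_zero, not_or] at hyy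
    simp only [Pi.mul_apply, h y hy hyy.1, h' y hy hyy.2, map_mul]
    field_simp
  add_mem' := by
    intro f g hf hg x hx
    obtain ⟨p, s, hs, h⟩ := hf x hx
    obtain ⟨p', s', hs', h'⟩ := hg x hx
    refine ⟨p * s' + p' * s, s * s', by simp [hs, hs'], fun y hy hyy => ?_⟩
    simp only [map_mul, ne_eq, mul_eq_zero, not_or] at hyy
    obtain ⟨h1, h2⟩ := hyy
    simp only [Pi.add_apply, h y hy h1, h' y hy h2, map_mul, map_add]
    field_simp
  algebraMap_mem' := by
    intro c x _
    refine ⟨MvPolynomial.C c, 1, by simp, fun y hy _ => ?_⟩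
    simp [evalJet]

noncomputable instance (l : Filter (JetQuotient n k)) : Algebra ℂ (Filter.Germ l ℂ) where
  algebraMap := (Filter.Germ.coeRingHom l).comp (algebraMap ℂ (JetQuotient n k → ℂ))
  commutes' _ _ := mul_comm _ _
  smul_def' c z := by
    induction z using Filter.Germ.inductionOn with
    | _ f => exact congrArg _ (Algebra.smul_def c f)

/-- The germ, along a filter containing the open set `U`, of a function on `U`. -/
noncomputable def toGerm (l : Filter (JetQuotient n k)) (U : Opens (JetQuotient n k))
    (hU : (U : Set (JetQuotient n k)) ∈ l) : (U → ℂ) →ₐ[ℂ] Filter.Germ l ℂ where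
  toFun f := ((Function.extend Subtype.val f 0 : JetQuotient n k → ℂ) : Filter.Germ l ℂ)
  map_one' := by
    refine Filter.Germ.coe_eq.mpr (Filter.mem_of_superset hU fun u hu => ?_)
    exact Subtype.val_injective.extend_apply (1 : U → ℂ) 0 ⟨u, hu⟩
  map_mul' f g := by
    refine Filter.Germ.coe_eq.mpr (Filter.mem_of_superset hU fun u hu => ?_)
    have e := fun h : U → ℂ => Subtype.val_injective.extend_apply h 0 ⟨u, hu⟩
    exact (e (f * g)).trans (congrArg₂ (· * ·) (e f) (e g)).symm
  map_zero' := by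
    refine Filter.Germ.coe_eq.mpr (Filter.mem_of_superset hU fun u hu => ?_)
    exact Subtype.val_injective.extend_apply (0 : U → ℂ) 0 ⟨u, hu⟩
  map_add' f g := by
    refine Filter.Germ.coe_eq.mpr (Filter.mem_of_superset hU fun u hu => ?_)
    have e := fun h : U → ℂ => Subtype.val_injective.extend_apply h 0 ⟨u, hu⟩
    exact (e (f + g)).trans (congrArg₂ (· + ·) (e f) (e g)).symm
  commutes' c := by
    refine Filter.Germ.coe_eq.mpr (Filter.mem_of_superset hU fun u hu => ?_)
    exact Subtype.val_injective.extend_apply (algebraMap ℂ (U → ℂ) c) 0 ⟨u, hu⟩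

theorem toGerm_restrict (l : Filter (JetQuotient n k)) {U V : Opens (JetQuotient n k)}
    (hU : (U : Set (JetQuotient n k)) ∈ l) (hV : (V : Set (JetQuotient n k)) ∈ l) (hVU : V ≤ U)
    (f : U → ℂ) : toGerm l V hV (fun v => f ⟨v.1, hVU v.2⟩) = toGerm l U hU f := by
  refine Filter.Germ.coe_eq.mpr (Filter.mem_of_superset hV fun u hu => ?_)
  exact (Subtype.val_injective.extend_apply (fun v : V => f ⟨v.1, hVU v.2⟩) 0 ⟨u, hu⟩).trans
    (Subtype.val_injective.extend_apply f 0 ⟨u, hVU hu⟩).symm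

theorem restrict_mem_regularFunctions {U V : Opens (JetQuotient n k)} (hVU : V ≤ U) {f : U → ℂ}
    (hf : f ∈ regularFunctions U) : (fun v : V => f ⟨v.1, hVU v.2⟩) ∈ regularFunctions V := by
  intro x hx
  obtain ⟨p, s, hs, h⟩ := hf x (hVU hx)
  exact ⟨p, s, hs, fun y hy hyy => h y (hVU hy) hyy⟩

/-- The germs, along a filter `l`, of the regular functions on the open sets `U` with property `P`,
a collection of sets in `l` that is stable under intersections. -/
def germSubalgebra (l : Filter (JetQuotient n k)) (P : Opens (JetQuotient n k) → Prop)
    (hPl : ∀ U, P U → (U : Set (JetQuotient n k)) ∈ l) (htop : P ⊤)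
    (hinf : ∀ U V, P U → P V → P (U ⊓ V)) : Subalgebra ℂ (Filter.Germ l ℂ) where
  carrier := {z | ∃ (U : Opens (JetQuotient n k)) (hU : P U), ∃ f ∈ regularFunctions U,
    toGerm l U (hPl U hU) f = z}
  mul_mem' := by
    rintro _ _ ⟨U, hU, f, hf, rfl⟩ ⟨V, hV, g, hg, rfl⟩
    refine ⟨U ⊓ V, hinf U V hU hV, _, mul_mem (restrict_mem_regularFunctions inf_le_left hf)
      (restrict_mem_regularFunctions inf_le_right hg), ?_⟩
    rw [map_mul, toGerm_restrict l (hPl U hU), toGerm_restrict l (hPl V hV)]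
  add_mem' := by
    rintro _ _ ⟨U, hU, f, hf, rfl⟩ ⟨V, hV, g, hg, rfl⟩
    refine ⟨U ⊓ V, hinf U V hU hV, _, add_mem (restrict_mem_regularFunctions inf_le_left hf)
      (restrict_mem_regularFunctions inf_le_right hg), ?_⟩
    rw [map_add, toGerm_restrict l (hPl U hU), toGerm_restrict l (hPl V hV)]
  algebraMap_mem' c := ⟨⊤, htop, algebraMap ℂ _ c, Subalgebra.algebraMap_mem _ c,
    AlgHom.commutes _ c⟩

/-- The stalk of the structure sheaf of `J_k ℂⁿ / G_k` at the point `q`. -/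
def stalk (q : JetQuotient n k) : Subalgebra ℂ (Filter.Germ (nhds q) ℂ) :=
  germSubalgebra (nhds q) (fun U => q ∈ U) (fun U hU => U.isOpen.mem_nhds hU)
    trivial (fun _ _ hU hV => ⟨hU, hV⟩)

/-- The germ at `q` of a regular function defined near `q`. -/
noncomputable def germ (U : Opens (JetQuotient n k)) (q : JetQuotient n k) (hq : q ∈ U) :
    regularFunctions U →ₐ[ℂ] stalk q :=
  ((toGerm (nhds q) U (U.isOpen.mem_nhds hq)).comp (regularFunctions U).val).codRestrict (stalk q)
    fun f => ⟨U, hq, f.1, f.2, rfl⟩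

/-- The ideal of the regular functions on `U` that vanish at `q`. -/
def vanishingIdeal (U : Opens (JetQuotient n k)) (q : JetQuotient n k) (hq : q ∈ U) :
    Ideal (regularFunctions U) :=
  RingHom.ker ((Pi.evalRingHom (fun _ : U => ℂ) ⟨q, hq⟩).comp (regularFunctions U).val.toRingHom)

instance (U : Opens (JetQuotient n k)) (q : JetQuotient n k) (hq : q ∈ U) :
    (vanishingIdeal U q hq).IsPrime :=
  RingHom.ker_isPrime _

/-! ### Rational functions and the normalization of `J_k ℂⁿ / G_k` -/

/-- The filter generated by the dense open subsets of `J_k ℂⁿ / G_k`. This space is irreducible,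
so these are its nonempty open subsets. -/
def genericFilter (n k : ℕ) : Filter (JetQuotient n k) where
  sets := {s | ∃ U : Set (JetQuotient n k), IsOpen U ∧ Dense U ∧ U ⊆ s}
  univ_sets := ⟨Set.univ, isOpen_univ, dense_univ, Set.subset_univ _⟩
  sets_of_superset := by
    rintro s t ⟨U, h1, h2, h3⟩ hst
    exact ⟨U, h1, h2, h3.trans hst⟩
  inter_sets := by
    rintro s t ⟨U, h1, h2, h3⟩ ⟨V, h4, h5, h6⟩
    exact ⟨U ∩ V, h1.inter h4, h2.inter_of_isOpen_left h5 h1, Set.inter_subset_inter h3 h6⟩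

/-- The field of rational functions on `J_k ℂⁿ / G_k`: regular functions on dense open subsets,
two of them being identified if they agree on a dense open subset. -/
noncomputable def functionField (n k : ℕ) : Subalgebra ℂ (Filter.Germ (genericFilter n k) ℂ) :=
  germSubalgebra (genericFilter n k) (fun U => Dense (U : Set (JetQuotient n k)))
    (fun U hU => ⟨U, U.isOpen, hU, subset_rfl⟩) dense_univ
    (fun U _ hU hV => hU.inter_of_isOpen_left hV U.isOpen)

/-- The local ring of `J_k ℂⁿ / G_k` at `q` inside the function field: the rational functions that
are regular at `q`. -/
noncomputable def localRing (q : JetQuotient n k) : Subalgebra ℂ (functionField n k) :=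
  (germSubalgebra (genericFilter n k) (fun U => Dense (U : Set (JetQuotient n k)) ∧ q ∈ U)
    (fun U hU => ⟨U, U.isOpen, hU.1, subset_rfl⟩) ⟨dense_univ, trivial⟩
    (fun U _ hU hV => ⟨hU.1.inter_of_isOpen_left hV.1 U.isOpen, hU.2, hV.2⟩)).comap
    (functionField n k).val

/-- The stalk at `q` of the integral closure of the structure sheaf in the function field. -/
noncomputable abbrev normalStalk (q : JetQuotient n k) :
    Subalgebra ℂ (functionField n k) :=
  (integralClosure (localRing q) (functionField n k)).restrictScalars ℂ

/-- The normalization of `J_k ℂⁿ / G_k`. Its points over a point `q` are the maximal ideals of the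
integral closure of the local ring at `q` in the function field. -/
structure Normalization (n k : ℕ) where
  /-- The image of the point under the normalization map. -/
  base : JetQuotient n k
  /-- The point in the fibre over `base`. -/
  point : MaximalSpectrum (normalStalk base)

/-- The topology of the normalization: over an open set `V` of the quotient, a basis is given by
the nonvanishing loci of rational functions integral over the structure sheaf on `V`. -/
instance (n k : ℕ) : TopologicalSpace (Normalization n k) :=
  TopologicalSpace.generateFrom
    {W | ∃ (V : Opens (JetQuotient n k)) (z : functionField n k),
      (∀ q ∈ V, z ∈ normalStalk q) ∧
      W = {x | x.base ∈ V ∧ ∀ h : z ∈ normalStalk x.base, ⟨z, h⟩ ∉ x.point.asIdeal}}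

/-- The local ring of the normalization at a point, inside the function field: the integral
closure of the local ring below, localized at the maximal ideal given by the point. -/
noncomputable def Normalization.localRing (x : Normalization n k) : Subalgebra ℂ (functionField n k) where
  carrier := {z | ∃ a b : normalStalk x.base, b ∉ x.point.asIdeal ∧
    z * (b : functionField n k) = a}
  mul_mem' := by
    rintro z w ⟨a, b, hb, h⟩ ⟨a', b', hb', h'⟩
    refine ⟨a * a', b * b', fun hm => ?_, ?_⟩
    · exact (x.point.isMaximal.isPrime.mem_or_mem hm).elim hb hb'
    · rw [Subalgebra.coe_mul, Subalgebra.coe_mul, ← h, ← h']; ring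
  add_mem' := by
    rintro z w ⟨a, b, hb, h⟩ ⟨a', b', hb', h'⟩
    refine ⟨a * b' + a' * b, b * b', fun hm => ?_, ?_⟩
    · exact (x.point.isMaximal.isPrime.mem_or_mem hm).elim hb hb'
    · rw [Subalgebra.coe_add, Subalgebra.coe_mul, Subalgebra.coe_mul, Subalgebra.coe_mul,
        ← h, ← h']; ring
  algebraMap_mem' c :=
    ⟨algebraMap ℂ (normalStalk x.base) c, 1,
      fun hm => x.point.isMaximal.ne_top ((Ideal.eq_top_iff_one _).mpr hm), by
        rw [Subalgebra.coe_one, mul_one, Subalgebra.coe_algebraMap]⟩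

/-- The structure sheaf of the normalization: the regular functions on `W` are the rational
functions that are regular at every point of `W`. -/
noncomputable def Normalization.regularFunctions (W : Opens (Normalization n k)) : Subalgebra ℂ (functionField n k) :=
  ⨅ x ∈ W, Normalization.localRing x

/-- The coordinate ring of the normalization of `J_k ℂⁿ / G_k`: its global regular functions. -/
noncomputable def Normalization.coordinateRing (n k : ℕ) : Subalgebra ℂ (functionField n k) :=
  Normalization.regularFunctions (⊤ : Opens (Normalization n k))

end InvJet

namespace InvJet

open Polynomial TopologicalSpace

variable {n k : ℕ}

/-! ### The Zariski topology -/

/-! Both claims come from explicit reparametrizations.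

For the coordinate ring, the dilations `t ↦ c t` with `c ≠ 0` lie in `G_k` and move every jet
towards `0` as `c → 0`. The orbit of `0` is therefore in the closure of every point of the quotient:
its only open neighbourhood is the whole space (`eq_top_of_proj_zero_mem`), and a regular function
there is constant (`regularFunctions_top_eq_const`). So the local ring at this orbit is `ℂ`. Since
the quotient is irreducible, `ℂ` is algebraically closed in the function field
(`mem_bot_of_isIntegral`), and the integral closure of that local ring is again `ℂ`. A single point
of the normalization over the orbit of `0` then forces the coordinate ring to be `ℂ`
(`coordinateRing_eq_bot`).

For a regular jet, some component has nonzero derivative, hence is itself a reparametrization, and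
composing with its inverse turns it into `t`. Each orbit in the chart where this is possible meets
the affine space of jets with `i`-th component `t` in exactly one point, given by `slice`. Regular
functions on the chart are the polynomials on this slice (`ofPolynomial_surjective`), and the stalks
are localizations as on any affine space. -/

/-- Principal open sets are only declared as a subbasis of `zariski`; closure under products makes
them a basis. -/
theorem exists_basicOpen_subset {S : Set (Jet n k)} (hS : @IsOpen _ (zariski n k) S) {x : Jet n k}
    (hx : x ∈ S) : ∃ h : MvPolynomial (Fin n × Fin k) ℂ, evalJet x h ≠ 0 ∧
      ∀ y, evalJet y h ≠ 0 → y ∈ S := by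
  change GenerateOpen _ S at hS
  induction hS with
  | basic U hU =>
    obtain ⟨p, rfl⟩ := hU
    exact ⟨p, hx, fun y hy => hy⟩
  | univ => exact ⟨1, by simp, fun _ _ => trivial⟩
  | inter U V _ _ hU hV =>
    obtain ⟨h, h1, h2⟩ := hU hx.1
    obtain ⟨h', h1', h2'⟩ := hV hx.2
    refine ⟨h * h', by simp [h1, h1'], fun y hy => ?_⟩
    rw [map_mul] at hy
    exact ⟨h2 y (left_ne_zero_of_mul hy), h2' y (right_ne_zero_of_mul hy)⟩
  | sUnion T _ hT =>
    obtain ⟨U, hU, hxU⟩ := hx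
    obtain ⟨h, h1, h2⟩ := hT U hU hxU
    exact ⟨h, h1, fun y hy => ⟨U, hU, h2 y hy⟩⟩

theorem isOpen_iff_basicOpen {W : Set (JetQuotient n k)} :
    IsOpen W ↔ ∀ x : Jet n k, proj x ∈ W → ∃ h : MvPolynomial (Fin n × Fin k) ℂ,
      evalJet x h ≠ 0 ∧ ∀ y : Jet n k, evalJet y h ≠ 0 → proj y ∈ W := by
  constructor
  · intro hW x hx
    exact exists_basicOpen_subset (S := proj ⁻¹' W) (isOpen_coinduced.mp hW) hx
  · intro H
    let _ := zariski n k
    refine isOpen_coinduced.mpr (isOpen_iff_forall_mem_open.mpr fun x hx => ?_)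
    obtain ⟨h, h1, h2⟩ := H x hx
    exact ⟨{y | evalJet y h ≠ 0}, h2, GenerateOpen.basic _ ⟨h, rfl⟩, h1⟩

theorem evalJet_eq_eval (x : Jet n k) (p : MvPolynomial (Fin n × Fin k) ℂ) :
    evalJet x p = MvPolynomial.eval (fun ij => x ij.1 ij.2) p := by
  rw [evalJet, MvPolynomial.aeval_eq_eval]

theorem eq_zero_of_forall_evalJet {p : MvPolynomial (Fin n × Fin k) ℂ}
    (hp : ∀ x : Jet n k, evalJet x p = 0) : p = 0 :=
  MvPolynomial.funext fun v => by
    simpa [evalJet_eq_eval] using hp (Matrix.of fun i j => v (i, j))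

theorem ne_zero_of_evalJet_ne_zero {p : MvPolynomial (Fin n × Fin k) ℂ} {x : Jet n k}
    (h : evalJet x p ≠ 0) : p ≠ 0 := by
  rintro rfl
  simp at h

theorem proj_surjective (q : JetQuotient n k) : ∃ x : Jet n k, proj x = q :=
  Quotient.exists_rep q

theorem toGerm_eq_iff {l : Filter (JetQuotient n k)} {U : Opens (JetQuotient n k)}
    (hU : (U : Set (JetQuotient n k)) ∈ l) (f g : U → ℂ) :
    toGerm l U hU f = toGerm l U hU g ↔ ∃ s ∈ l, ∀ u (hu : u ∈ U), u ∈ s → f ⟨u, hu⟩ = g ⟨u, hu⟩ := by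
  have e := fun (h : U → ℂ) u hu => Subtype.val_injective.extend_apply h 0 (⟨u, hu⟩ : U)
  constructor
  · intro h
    refine ⟨_, Filter.Germ.coe_eq.mp h, fun u hu hus => ?_⟩
    exact ((e f u hu).symm.trans hus).trans (e g u hu)
  · rintro ⟨s, hs, h⟩
    refine Filter.Germ.coe_eq.mpr (Filter.mem_of_superset (Filter.inter_mem hU hs) ?_)
    rintro u ⟨hu, hus⟩
    exact (e f u hu).trans ((h u hu hus).trans (e g u hu).symm)

/-! ### Global regular functions are constant -/

/-- The jet of `t ↦ f(c t)`. -/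
def dilate (c : ℂ) (x : Jet n k) : Jet n k := Matrix.of fun i j => c ^ (j.val + 1) * x i j

theorem proj_dilate {c : ℂ} (hc : c ≠ 0) (x : Jet n k) : proj (dilate c x) = proj x := by
  have hm : ∀ c : ℂ, substMatrix k (C c * X) = Matrix.diagonal fun j => c ^ (j.val + 1) := by
    intro c
    ext i j
    simp only [substMatrix, Matrix.of_apply, mul_pow, ← C_pow, coeff_C_mul, coeff_X_pow,
      Matrix.diagonal_apply, Fin.ext_iff, add_left_inj, eq_comm (a := j.val)]
    split_ifs <;> simp
  refine Quotient.sound ((orbitSetoid n k).symm' ?_)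
  refine ⟨⟨substMatrix k (C c * X), substMatrix k (C c⁻¹ * X), ?_, ?_⟩, ⟨C c * X, ?_, ?_, rfl⟩, ?_⟩
  · simp [hm, Matrix.diagonal_mul_diagonal, hc]
  · simp [hm, Matrix.diagonal_mul_diagonal, hc]
  · simp
  · simpa using hc
  · simp only [hm]
    ext i j
    simp [dilate, mul_comm]

/-- The restriction of a polynomial to the curve `c ↦ dilate c x`. -/
noncomputable def alongDilate (x : Jet n k) : MvPolynomial (Fin n × Fin k) ℂ →ₐ[ℂ] ℂ[X] :=
  MvPolynomial.aeval fun ij => X ^ (ij.2.val + 1) * C (x ij.1 ij.2)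

theorem eval_alongDilate (x : Jet n k) (c : ℂ) (p : MvPolynomial (Fin n × Fin k) ℂ) :
    (alongDilate x p).eval c = evalJet (dilate c x) p := by
  have : (Polynomial.aeval c).comp (alongDilate x) = evalJet (dilate c x) := by
    ext ij
    simp only [alongDilate, evalJet, dilate, AlgHom.comp_apply, MvPolynomial.aeval_X, map_mul,
      map_pow, aeval_X, aeval_C, Matrix.of_apply]
    rfl
  rw [← this, AlgHom.comp_apply, Polynomial.coe_aeval_eq_eval]

theorem dilate_zero (x : Jet n k) : dilate 0 x = 0 := by
  ext i j; simp [dilate]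

theorem eq_top_of_proj_zero_mem {U : Opens (JetQuotient n k)}
    (hU : proj (0 : Jet n k) ∈ U) : U = ⊤ := by
  refine Opens.ext (Set.eq_univ_of_forall fun q => ?_)
  obtain ⟨x, rfl⟩ := proj_surjective q
  obtain ⟨h, h1, h2⟩ := isOpen_iff_basicOpen.mp U.isOpen 0 hU
  -- The factor `X` excludes the root `c = 0`, where the dilation is not in the group.
  have hne : alongDilate x h * X ≠ 0 := by
    refine mul_ne_zero ?_ X_ne_zero
    intro h0
    rw [← dilate_zero x, ← eval_alongDilate, h0] at h1
    simp at h1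
  obtain ⟨c, hc⟩ : ∃ c, (alongDilate x h * X).eval c ≠ 0 := by
    by_contra! H
    exact hne (Polynomial.funext fun c => by rw [H c, eval_zero])
  simp only [eval_mul, eval_X, eval_alongDilate] at hc
  rw [← proj_dilate (right_ne_zero_of_mul hc) x]
  exact h2 _ (left_ne_zero_of_mul hc)

theorem regularFunctions_top_eq_const {f : (⊤ : Opens (JetQuotient n k)) → ℂ}
    (hf : f ∈ regularFunctions ⊤) (q : (⊤ : Opens (JetQuotient n k))) :
    f q = f ⟨proj 0, trivial⟩ := by
  obtain ⟨q, hq⟩ := q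
  obtain ⟨x, rfl⟩ := proj_surjective q
  obtain ⟨p, s, hs, h⟩ := hf 0 trivial
  -- Along the dilation curve `f` is constantly `f (proj x)`, so `f (proj x) * s = p` wherever `c ≠
  -- 0` and `s ≠ 0`. The first factor covers the exceptional `c`; cancelling it extends the identity
  -- to `c = 0`.
  have key : (alongDilate x s * X) * (C (f ⟨proj x, hq⟩) * alongDilate x s - alongDilate x p) = 0 := by
    refine Polynomial.funext fun c => ?_
    simp only [eval_mul, eval_X, eval_sub, eval_C, eval_zero, eval_alongDilate]
    by_cases hc : c = 0
    · simp [hc]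
    by_cases hsc : evalJet (dilate c x) s = 0
    · simp [hsc]
    have h1 := h (dilate c x) trivial hsc
    simp only [proj_dilate hc x] at h1
    rw [h1]
    field_simp
    simp
  have hne : alongDilate x s ≠ 0 := by
    intro h0
    rw [← dilate_zero x, ← eval_alongDilate, h0] at hs
    simp at hs
  have h2 := (mul_eq_zero.mp key).resolve_left (mul_ne_zero hne X_ne_zero)
  have h3 := congrArg (Polynomial.eval 0) h2
  simp only [eval_mul, eval_sub, eval_C, eval_zero, eval_alongDilate, dilate_zero] at h3
  rw [h 0 trivial hs, eq_div_iff hs]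
  exact sub_eq_zero.mp h3

/-! ### The coordinate ring of the normalization -/

theorem localRing_proj_zero : localRing (proj (0 : Jet n k)) = ⊥ := by
  rw [eq_bot_iff]
  rintro z ⟨U, hU, f, hf, hfz⟩
  obtain rfl := eq_top_of_proj_zero_mem hU.2
  refine Algebra.mem_bot.mpr ⟨f ⟨proj 0, trivial⟩, Subtype.ext ?_⟩
  refine Eq.trans ?_ hfz
  have : f = algebraMap ℂ _ (f ⟨proj 0, trivial⟩) := funext (regularFunctions_top_eq_const hf)
  conv_rhs => rw [this, AlgHom.commutes]
  rfl

/-- Makes the function field nontrivial, so that the normalization has a point over the orbit of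
`0`. -/
instance : (genericFilter n k).NeBot := by
  refine ⟨fun h => ?_⟩
  obtain ⟨U, -, hU, hU'⟩ := Filter.empty_mem_iff_bot.mpr h
  exact (hU.nonempty_iff.mpr ⟨proj 0⟩).not_subset_empty hU'

/-- On an open subset of the irreducible quotient, a regular function with values among the roots of
a nonzero polynomial is constant. -/
theorem eq_const_of_forall_eval_eq_zero {V : Opens (JetQuotient n k)} {f : V → ℂ}
    (hf : f ∈ regularFunctions V) {P : ℂ[X]} (hP : P ≠ 0) (h : ∀ v, P.eval (f v) = 0) :
    ∃ c, ∀ v, f v = c := by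
  rcases isEmpty_or_nonempty V with _ | ⟨⟨v, hv⟩⟩
  · exact ⟨0, fun v => isEmptyElim v⟩
  obtain ⟨x, rfl⟩ := proj_surjective v
  obtain ⟨p, s, hs, hps⟩ := hf x hv
  obtain ⟨h₁, hx₁, hV⟩ := isOpen_iff_basicOpen.mp V.isOpen x hv
  -- Near `x` each value `p / s` is a root of `P`, so this product vanishes everywhere. Polynomials
  -- form a domain, hence a single root `c` gives `p = c * s` identically.
  have hprod : (h₁ * s) * (P.roots.map fun c => p - MvPolynomial.C c * s).prod = 0 := by
    refine eq_zero_of_forall_evalJet fun y => ?_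
    rw [map_mul, mul_eq_zero, or_iff_not_imp_left]
    intro hy
    rw [map_mul] at hy
    have hyV := hV y (left_ne_zero_of_mul hy)
    have hys := right_ne_zero_of_mul hy
    rw [map_multiset_prod, Multiset.map_map]
    refine Multiset.prod_eq_zero (Multiset.mem_map.mpr ⟨f ⟨proj y, hyV⟩, ?_, ?_⟩)
    · exact (mem_roots hP).mpr (h _)
    · rw [hps y hyV hys]
      have hC : ∀ c, evalJet y (MvPolynomial.C c) = c := fun c => by simp [evalJet]
      simp [hC, div_mul_cancel₀ _ hys]
  have h2 := (mul_eq_zero.mp hprod).resolve_left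
    (mul_ne_zero (ne_zero_of_evalJet_ne_zero hx₁) (ne_zero_of_evalJet_ne_zero hs))
  obtain ⟨c, -, hc⟩ := Multiset.mem_map.mp (Multiset.prod_eq_zero_iff.mp h2)
  refine ⟨c, ?_⟩
  rintro ⟨w, hw⟩
  obtain ⟨y, rfl⟩ := proj_surjective w
  obtain ⟨p', s', hs', hps'⟩ := hf y hw
  -- Irreducibility carries the constant from `x` to `y`: the two local fractions agree on a
  -- nonempty principal open set, hence as rational functions.
  have hzero : (h₁ * s * s') * (p' - MvPolynomial.C c * s') = 0 := by
    refine eq_zero_of_forall_evalJet fun z => ?_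
    rw [map_mul, mul_eq_zero, or_iff_not_imp_left]
    intro hz
    simp only [map_mul, mul_eq_zero, not_or] at hz
    obtain ⟨⟨hz1, hz2⟩, hz3⟩ := hz
    have hzV := hV z hz1
    have e1 := hps z hzV hz2
    rw [hps' z hzV hz3, sub_eq_zero.mp hc, map_mul, mul_div_cancel_right₀ _ hz2,
      div_eq_iff hz3] at e1
    simp [e1]
  have h3 := (mul_eq_zero.mp hzero).resolve_left
    (mul_ne_zero (mul_ne_zero (ne_zero_of_evalJet_ne_zero hx₁) (ne_zero_of_evalJet_ne_zero hs))
      (ne_zero_of_evalJet_ne_zero hs'))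
  rw [hps' y hw hs', sub_eq_zero.mp h3, map_mul, mul_div_cancel_right₀ _ hs']
  simp [evalJet]

theorem mem_genericFilter {U : Opens (JetQuotient n k)} (hU : Dense (U : Set (JetQuotient n k))) :
    (U : Set (JetQuotient n k)) ∈ genericFilter n k :=
  ⟨U, U.isOpen, hU, subset_rfl⟩

/-- `ℂ` is algebraically closed in the function field. -/
theorem mem_bot_of_isIntegral {z : functionField n k} (hz : IsIntegral ℂ z) :
    z ∈ (⊥ : Subalgebra ℂ (functionField n k)) := by
  obtain ⟨P, hP, hPz⟩ := hz
  obtain ⟨z, U, hU, f, hf, rfl⟩ := z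
  have h0 : Polynomial.aeval (toGerm (genericFilter n k) U (mem_genericFilter hU) f) P = 0 := by
    have := congrArg (functionField n k).val hPz
    rw [← Polynomial.aeval_def, ← Polynomial.aeval_algHom_apply] at this
    exact this.trans (map_zero _)
  rw [Polynomial.aeval_algHom_apply] at h0
  -- The equation `P(z) = 0` between germs holds pointwise on a dense open set, where `f` thus takes
  -- values among the roots of `P`.
  obtain ⟨s, ⟨W, hWo, hWd, hWs⟩, hs⟩ := (toGerm_eq_iff _ _ _).mp (h0.trans (map_zero _).symm)
  have hV : Dense ((U : Set (JetQuotient n k)) ∩ W) := hU.inter_of_isOpen_left hWd U.isOpen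
  let V : Opens (JetQuotient n k) := U ⊓ ⟨W, hWo⟩
  obtain ⟨c, hc⟩ := eq_const_of_forall_eval_eq_zero
    (restrict_mem_regularFunctions (V := V) inf_le_left hf) hP.ne_zero (fun v => by
      have h1 := hs v.1 v.2.1 (hWs v.2.2)
      have h2 : Polynomial.aeval f P ⟨v.1, v.2.1⟩ = P.eval (f ⟨v.1, v.2.1⟩) := by
        have := Polynomial.aeval_algHom_apply (Pi.evalAlgHom ℂ (fun _ : U => ℂ) ⟨v.1, v.2.1⟩) f P
        rw [Polynomial.coe_aeval_eq_eval] at this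
        exact this.symm
      rw [← h2]; exact h1)
  refine Algebra.mem_bot.mpr ⟨c, Subtype.ext ?_⟩
  change algebraMap ℂ (Filter.Germ (genericFilter n k) ℂ) c = _
  rw [← AlgHom.commutes (toGerm (genericFilter n k) U (mem_genericFilter hU))]
  exact (toGerm_eq_iff _ _ _).mpr ⟨V, mem_genericFilter hV, fun u hu huV => (hc ⟨u, huV⟩).symm⟩

/-- Integrality over the local ring, which is `ℂ`, is integrality over `ℂ` by transitivity. -/
theorem normalStalk_proj_zero : normalStalk (proj (0 : Jet n k)) = ⊥ := by
  rw [eq_bot_iff]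
  intro z hz
  have hz' : IsIntegral (localRing (proj (0 : Jet n k))) z := hz
  refine mem_bot_of_isIntegral ?_
  have : Algebra.IsIntegral ℂ (localRing (proj (0 : Jet n k))) := by
    rw [localRing_proj_zero]
    refine ⟨fun w => ?_⟩
    obtain ⟨c, hc⟩ := Algebra.mem_bot.mp w.2
    have : w = algebraMap ℂ _ c := Subtype.ext hc.symm
    rw [this]
    exact isIntegral_algebraMap
  exact isIntegral_trans z hz'

theorem coordinateRing_eq_bot : Normalization.coordinateRing n k = ⊥ := by
  rw [eq_bot_iff]
  intro z hz
  obtain ⟨m, hm⟩ := Ideal.exists_maximal (normalStalk (proj (0 : Jet n k)))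
  simp only [Normalization.coordinateRing, Normalization.regularFunctions, Algebra.mem_iInf] at hz
  obtain ⟨a, b, hb, hzb⟩ := hz ⟨proj 0, ⟨m, hm⟩⟩ trivial
  have hbot : ∀ w : normalStalk (proj (0 : Jet n k)),
      ∃ c, algebraMap ℂ (functionField n k) c = w := fun w =>
    Algebra.mem_bot.mp (normalStalk_proj_zero.le w.2)
  obtain ⟨c, hc⟩ := hbot a
  obtain ⟨d, hd⟩ := hbot b
  have hd0 : d ≠ 0 := by
    rintro rfl
    refine hb ?_
    have : b = 0 := Subtype.ext (hd.symm.trans (map_zero _))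
    rw [this]
    exact zero_mem _
  refine Algebra.mem_bot.mpr ⟨c * d⁻¹, ?_⟩
  rw [map_mul, hc, ← hzb, ← hd, mul_assoc, ← map_mul, mul_inv_cancel₀ hd0, map_one, mul_one]

theorem finiteType_coordinateRing : Algebra.FiniteType ℂ (Normalization.coordinateRing n k) := by
  rw [coordinateRing_eq_bot]
  exact (Subalgebra.fg_iff_finiteType _).mp Subalgebra.fg_bot

/-! ### The slice through the regular orbits -/

/-- A function on affine space that is locally a quotient of polynomials is a polynomial. -/
theorem exists_evalJet_eq {F : Jet n k → ℂ}
    (hF : ∀ x, ∃ p s : MvPolynomial (Fin n × Fin k) ℂ, evalJet x s ≠ 0 ∧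
      ∀ y, evalJet y s ≠ 0 → F y = evalJet y p / evalJet y s) :
    ∃ P : MvPolynomial (Fin n × Fin k) ℂ, ∀ y, F y = evalJet y P := by
  let I : Ideal (MvPolynomial (Fin n × Fin k) ℂ) :=
    { carrier := {s | ∃ P : MvPolynomial (Fin n × Fin k) ℂ,
        ∀ y, F y * evalJet y s = evalJet y P}
      add_mem' := by
        rintro a b ⟨P, hP⟩ ⟨Q, hQ⟩
        exact ⟨P + Q, fun y => by rw [map_add, map_add, mul_add, hP, hQ]⟩
      zero_mem' := ⟨0, fun y => by simp⟩
      smul_mem' := by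
        rintro c a ⟨P, hP⟩
        exact ⟨c * P, fun y => by rw [smul_eq_mul, map_mul, map_mul, mul_left_comm, hP]⟩ }
  -- `I` is the ideal of denominators of `F`. By the Nullstellensatz a proper ideal vanishes at some
  -- point, yet `F` has a denominator nonzero at any given point.
  have hI : I = ⊤ := by
    by_contra hne
    obtain ⟨M, hM, hIM⟩ := Ideal.exists_le_maximal I hne
    obtain ⟨v, rfl⟩ := MvPolynomial.isMaximal_iff_eq_vanishingIdeal_singleton.mp hM
    obtain ⟨p, s, hs, h⟩ := hF (Matrix.of fun i j => v (i, j))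
    -- The equality `F = p / s` is known only where `s ≠ 0`; the second factor `s` makes the
    -- identity hold on its zero set too.
    have hmem : s * s ∈ I := by
      refine ⟨p * s, fun y => ?_⟩
      by_cases hy : evalJet y s = 0
      · simp [hy]
      · rw [h y hy, map_mul, map_mul]
        field_simp
    have h0 := (MvPolynomial.mem_vanishingIdeal_singleton_iff v (s * s)).mp (hIM hmem)
    rw [map_mul] at h0
    exact hs (mul_self_eq_zero.mp h0)
  obtain ⟨P, hP⟩ : (1 : MvPolynomial (Fin n × Fin k) ℂ) ∈ I := hI ▸ Submodule.mem_top
  exact ⟨P, fun y => by simpa using hP y⟩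

/-- The polynomial with coefficients `a` and without constant term. -/
noncomputable def rowPoly {R : Type*} [CommRing R] (a : Fin k → R) : R[X] :=
  ∑ j : Fin k, C (a j) * X ^ (j.val + 1)

theorem coeff_rowPoly {R : Type*} [CommRing R] (a : Fin k → R) (j : Fin k) :
    (rowPoly a).coeff (j.val + 1) = a j := by
  simp [rowPoly, coeff_X_pow, ← Fin.ext_iff]

theorem coeff_zero_rowPoly {R : Type*} [CommRing R] (a : Fin k → R) :
    (rowPoly a).coeff 0 = 0 := by
  simp [rowPoly, coeff_X_pow]

theorem map_rowPoly {R S : Type*} [CommRing R] [CommRing S] (f : R →+* S) (a : Fin k → R) :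
    (rowPoly a).map f = rowPoly fun j => f (a j) := by
  simp [rowPoly, Polynomial.map_sum]

/-- The matrix of the reparametrization given by the `i`-th component of a jet. -/
noncomputable def reparamMatrix (i : Fin n) (x : Jet n k) : Matrix (Fin k) (Fin k) ℂ :=
  substMatrix k (rowPoly (x i))

/-- The group acts by composing every component with `φ`, and `substMatrix` turns composition into a
product. This equivariance makes `slice` constant on orbits. -/
theorem reparamMatrix_mul (i : Fin n) (x : Jet n k) {φ : ℂ[X]} (hφ : φ.coeff 0 = 0) :
    reparamMatrix i (x * substMatrix k φ) = reparamMatrix i x * substMatrix k φ := by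
  rw [reparamMatrix, reparamMatrix, substMatrix_mul k _ _ (coeff_zero_rowPoly _) hφ]
  refine substMatrix_congr k _ _ fun j hj => ?_
  cases j with
  | zero => rw [coeff_zero_rowPoly, comp_coeff_zero _ _ (coeff_zero_rowPoly _) hφ]
  | succ j =>
    have h1 := coeff_rowPoly ((x * substMatrix k φ) i) ⟨j, hj⟩
    have h2 := coeff_comp_eq_sum k (rowPoly (x i)) φ (coeff_zero_rowPoly _) hφ ⟨j, hj⟩
    simp only [coeff_rowPoly] at h1 h2
    rw [h1, h2]
    rfl

theorem coeff_pow_of_coeff_zero {φ : ℂ[X]} (hφ : φ.coeff 0 = 0) (m : ℕ) :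
    (∀ j < m, (φ ^ m).coeff j = 0) ∧ (φ ^ m).coeff m = φ.coeff 1 ^ m := by
  obtain ⟨r, rfl⟩ := X_dvd_iff.mpr hφ
  rw [mul_pow]
  refine ⟨fun j hj => by rw [coeff_X_pow_mul', if_neg (by omega)], ?_⟩
  rw [coeff_X_pow_mul', if_pos le_rfl, Nat.sub_self, coeff_X_mul, coeff_zero_eq_eval_zero,
    coeff_zero_eq_eval_zero, eval_pow]

theorem det_substMatrix_ne_zero {φ : ℂ[X]} (h0 : φ.coeff 0 = 0) (h1 : φ.coeff 1 ≠ 0) :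
    (substMatrix k φ).det ≠ 0 := by
  rw [Matrix.det_of_isUpperTriangular]
  · refine Finset.prod_ne_zero_iff.mpr fun i _ => ?_
    rw [substMatrix, Matrix.of_apply, (coeff_pow_of_coeff_zero h0 _).2]
    exact pow_ne_zero _ h1
  · intro i j hij
    exact (coeff_pow_of_coeff_zero h0 _).1 _ (Nat.succ_lt_succ hij)

/-- The universal `reparamMatrix`. -/
noncomputable def genericReparamMatrix (n k : ℕ) (i : Fin n) :
    Matrix (Fin k) (Fin k) (MvPolynomial (Fin n × Fin k) ℂ) :=
  Matrix.of fun a b =>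
    (rowPoly (fun j => (MvPolynomial.X (i, j) : MvPolynomial (Fin n × Fin k) ℂ)) ^
      (a.val + 1)).coeff (b.val + 1)

theorem mapMatrix_genericReparamMatrix (i : Fin n) (x : Jet n k) :
    (evalJet x).toRingHom.mapMatrix (genericReparamMatrix n k i) = reparamMatrix i x := by
  ext a b
  simp only [RingHom.mapMatrix_apply, Matrix.map_apply, genericReparamMatrix, Matrix.of_apply,
    reparamMatrix, substMatrix, ← Polynomial.coeff_map, Polynomial.map_pow, map_rowPoly]
  simp [evalJet]

theorem evalJet_det (i : Fin n) (x : Jet n k) :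
    evalJet x (genericReparamMatrix n k i).det = (reparamMatrix i x).det := by
  rw [← mapMatrix_genericReparamMatrix, ← RingHom.map_det]; rfl

/-- The representative of an orbit whose `i`-th component is `t`. -/
noncomputable def slice (i : Fin n) : JetQuotient n k → Jet n k :=
  Quotient.lift (fun x : Jet n k => x * (reparamMatrix i x)⁻¹) <| by
    rintro x _ ⟨g, ⟨φ, h0, h1, hg⟩, rfl⟩
    have hu : IsUnit (substMatrix k φ).det := (det_substMatrix_ne_zero h0 h1).isUnit
    simp only [hg]
    -- `Matrix.mul_inv_rev` needs no invertibility, so the lift is legitimate off the chart too,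
    -- where the inverse is `0` by convention.
    rw [reparamMatrix_mul i x h0, Matrix.mul_inv_rev, ← Matrix.mul_assoc,
      Matrix.mul_nonsing_inv_cancel_right _ _ hu]

theorem slice_proj (i : Fin n) (x : Jet n k) :
    slice i (proj x) = x * (reparamMatrix i x)⁻¹ := rfl

/-- The locus where the `i`-th component is a reparametrization. -/
def chart (n k : ℕ) (i : Fin n) : Opens (JetQuotient n k) where
  carrier := {q | ∃ x : Jet n k, proj x = q ∧ (reparamMatrix i x).det ≠ 0}
  is_open' := by
    refine isOpen_iff_basicOpen.mpr ?_
    rintro x ⟨y, hy, hdet⟩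
    obtain ⟨g, ⟨φ, h0, h1, hg⟩, rfl⟩ := Quotient.exact hy
    refine ⟨(genericReparamMatrix n k i).det, ?_, fun z hz => ⟨z, rfl, ?_⟩⟩
    · rw [evalJet_det, hg, reparamMatrix_mul i y h0, Matrix.det_mul]
      exact mul_ne_zero hdet (det_substMatrix_ne_zero h0 h1)
    · rwa [evalJet_det] at hz

theorem proj_mem_chart {i : Fin n} {x : Jet n k} :
    proj x ∈ chart n k i ↔ (reparamMatrix i x).det ≠ 0 := by
  refine ⟨?_, fun h => ⟨x, rfl, h⟩⟩
  rintro ⟨y, hy, hdet⟩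
  obtain ⟨g, ⟨φ, h0, h1, hg⟩, rfl⟩ := Quotient.exact hy
  rw [hg, reparamMatrix_mul i y h0, Matrix.det_mul]
  exact mul_ne_zero hdet (det_substMatrix_ne_zero h0 h1)

theorem Jet.IsRegular.exists_mem_chart {x : Jet n k} (hx : x.IsRegular) :
    ∃ i, proj x ∈ chart n k i := by
  obtain ⟨i, j, hj, h⟩ := hx
  refine ⟨i, proj_mem_chart.mpr (det_substMatrix_ne_zero (coeff_zero_rowPoly _) ?_)⟩
  have := coeff_rowPoly (x i) j
  rw [hj, zero_add] at this
  rwa [this]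

/-- The affine map that replaces the `i`-th component of a jet by `t`. -/
def setRow (i : Fin n) (x : Jet n k) : Jet n k :=
  Matrix.of fun a j => if a = i then (if j.val = 0 then 1 else 0) else x a j

theorem reparamMatrix_setRow (i : Fin n) (x : Jet n k) : reparamMatrix i (setRow i x) = 1 := by
  rw [reparamMatrix, ← substMatrix_X]
  refine substMatrix_congr k _ _ fun j hj => ?_
  cases j with
  | zero => simp [coeff_zero_rowPoly]
  | succ j =>
    have h := coeff_rowPoly (setRow i x i) ⟨j, hj⟩
    simp only at h
    rw [h]
    simp [setRow, coeff_X, eq_comm]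

theorem proj_setRow_mem_chart (i : Fin n) (x : Jet n k) : proj (setRow i x) ∈ chart n k i :=
  proj_mem_chart.mpr (by simp [reparamMatrix_setRow])

theorem reparamMatrix_row (hk : 1 ≤ k) (i : Fin n) (x : Jet n k) (j : Fin k) :
    reparamMatrix i x ⟨0, hk⟩ j = x i j := by
  simp [reparamMatrix, substMatrix, coeff_rowPoly]

theorem proj_slice {i : Fin n} {q : JetQuotient n k} (hq : q ∈ chart n k i) :
    proj (slice i q) = q := by
  obtain ⟨x, rfl, hdet⟩ := hq
  rcases Nat.eq_zero_or_pos k with rfl | hk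
  · exact congrArg proj (Subsingleton.elim _ _)
  refine Quotient.sound ⟨Matrix.GeneralLinearGroup.mk'' _ hdet.isUnit,
    ⟨rowPoly (x i), coeff_zero_rowPoly _, ?_, rfl⟩, ?_⟩
  -- If the linear coefficient vanished, so would the first column of the matrix, as every power of
  -- the component has no term in `t`.
  · intro h
    refine hdet (Matrix.det_eq_zero_of_column_eq_zero ⟨0, hk⟩ fun a => ?_)
    have := coeff_pow_of_coeff_zero (coeff_zero_rowPoly (x i)) (a.val + 1)
    rcases Nat.eq_zero_or_pos a.val with ha | ha
    · have h2 := this.2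
      rw [h, zero_pow (Nat.succ_ne_zero _), ha] at h2
      rw [reparamMatrix, substMatrix, Matrix.of_apply, ha]
      exact h2
    · exact this.1 1 (by omega)
  · exact Matrix.nonsing_inv_mul_cancel_right _ _ hdet.isUnit

/-- The first row of `reparamMatrix i x` is the `i`-th row of `x`, so the `i`-th row of `x *
(reparamMatrix i x)⁻¹` is the first row of the identity, that is, the jet of `t`. -/
theorem setRow_slice {i : Fin n} {q : JetQuotient n k} (hq : q ∈ chart n k i) :
    setRow i (slice i q) = slice i q := by
  obtain ⟨x, rfl, hdet⟩ := hq
  ext a j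
  by_cases ha : a = i
  · subst ha
    have hk : 1 ≤ k := by have := j.isLt; omega
    have h := congrFun (congrFun (Matrix.mul_nonsing_inv _ hdet.isUnit) ⟨0, hk⟩) j
    simp only [Matrix.mul_apply, reparamMatrix_row] at h
    rw [slice_proj, Matrix.mul_apply, h]
    simp [setRow, Matrix.one_apply, Fin.ext_iff, eq_comm]
  · simp [setRow, ha]

theorem slice_mem_regularFunctions (i : Fin n) (a : Fin n) (b : Fin k) :
    (fun u : chart n k i => slice i u.1 a b) ∈ regularFunctions (chart n k i) := by
  intro x hx
  -- Cramer's rule writes the inverse as adjugate over determinant, and the determinant is nonzero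
  -- on the chart.
  refine ⟨∑ c, MvPolynomial.X (a, c) * (genericReparamMatrix n k i).adjugate c b,
    (genericReparamMatrix n k i).det, ?_, fun y hy hyy => ?_⟩
  · rw [evalJet_det]; exact proj_mem_chart.mp hx
  · have hadj : ∀ c, evalJet y ((genericReparamMatrix n k i).adjugate c b)
        = (reparamMatrix i y).adjugate c b := fun c => by
      rw [← mapMatrix_genericReparamMatrix, ← RingHom.map_adjugate]; rfl
    simp only [slice_proj, Matrix.mul_apply, Matrix.inv_def, Matrix.smul_apply,
      Ring.inverse_eq_inv', smul_eq_mul, map_sum, map_mul, hadj, evalJet_det]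
    rw [Finset.sum_div]
    refine Finset.sum_congr rfl fun c _ => ?_
    simp [evalJet]
    ring

/-- The regular functions on the chart are the polynomials on the slice. -/
noncomputable def ofPolynomial (n k : ℕ) (i : Fin n) :
    MvPolynomial (Fin n × Fin k) ℂ →ₐ[ℂ] regularFunctions (chart n k i) :=
  MvPolynomial.aeval fun ab => ⟨_, slice_mem_regularFunctions i ab.1 ab.2⟩

theorem ofPolynomial_apply (i : Fin n) (p : MvPolynomial (Fin n × Fin k) ℂ) (u : chart n k i) :
    (ofPolynomial n k i p).1 u = evalJet (slice i u.1) p := by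
  have : ((Pi.evalAlgHom ℂ (fun _ : chart n k i => ℂ) u).comp
      (regularFunctions (chart n k i)).val).comp (ofPolynomial n k i)
      = evalJet (slice i u.1) := by
    ext ab
    simp [ofPolynomial, evalJet]
  exact DFunLike.congr_fun this p

/-- Composition of polynomials with `setRow`. -/
noncomputable def setRowHom (n k : ℕ) (i : Fin n) :
    MvPolynomial (Fin n × Fin k) ℂ →ₐ[ℂ] MvPolynomial (Fin n × Fin k) ℂ :=
  MvPolynomial.aeval fun ab =>
    if ab.1 = i then (if ab.2.val = 0 then 1 else 0) else MvPolynomial.X ab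

theorem evalJet_setRowHom (i : Fin n) (x : Jet n k) (p : MvPolynomial (Fin n × Fin k) ℂ) :
    evalJet x (setRowHom n k i p) = evalJet (setRow i x) p := by
  have : (evalJet x).comp (setRowHom n k i) = evalJet (setRow i x) := by
    ext ab
    obtain ⟨a, b⟩ := ab
    by_cases ha : a = i
    · subst ha
      by_cases hb : b.val = 0 <;> simp [setRowHom, evalJet, setRow, hb]
    · simp [setRowHom, evalJet, setRow, ha]
  exact DFunLike.congr_fun this p

/-- Since `setRow` maps all of affine space into the chart, pulling `f` back along it gives a
function that is everywhere locally a fraction, hence a polynomial. On the slice `setRow` is the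
identity, so this polynomial recovers `f`. -/
theorem ofPolynomial_surjective (i : Fin n) : Function.Surjective (ofPolynomial n k i) := by
  rintro ⟨f, hf⟩
  obtain ⟨P, hP⟩ := exists_evalJet_eq
    (F := fun y => f ⟨proj (setRow i y), proj_setRow_mem_chart i y⟩) (fun x => by
      obtain ⟨p, s, hs, h⟩ := hf (setRow i x) (proj_setRow_mem_chart i x)
      refine ⟨setRowHom n k i p, setRowHom n k i s, ?_, fun y hy => ?_⟩
      · rwa [evalJet_setRowHom]
      · rw [evalJet_setRowHom] at hy ⊢
        rw [evalJet_setRowHom]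
        exact h _ _ hy)
  refine ⟨P, Subtype.ext (funext fun u => ?_)⟩
  rw [ofPolynomial_apply, ← hP]
  congr 1
  exact Subtype.ext ((congrArg proj (setRow_slice u.2)).trans (proj_slice u.2))

/-! ### Stalks over the chart as localizations -/

/-- The locus in an open set where a regular function does not vanish. -/
def nonvanishing {U : Opens (JetQuotient n k)} (f : regularFunctions U) :
    Opens (JetQuotient n k) where
  carrier := {q | ∃ hq : q ∈ U, f.1 ⟨q, hq⟩ ≠ 0}
  is_open' := by
    refine isOpen_iff_basicOpen.mpr ?_
    rintro x ⟨hx, hfx⟩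
    obtain ⟨h, h1, h2⟩ := isOpen_iff_basicOpen.mp U.isOpen x hx
    obtain ⟨p, s, hs, hps⟩ := f.2 x hx
    rw [hps x hx hs] at hfx
    refine ⟨h * s * p, mul_ne_zero (mul_ne_zero h1 hs) (left_ne_zero_of_mul hfx) ∘ by simp,
      fun y hy => ?_⟩
    simp only [map_mul, ne_eq, mul_eq_zero, not_or] at hy
    obtain ⟨⟨hy1, hy2⟩, hy3⟩ := hy
    exact ⟨h2 y hy1, by rw [hps y _ hy2]; exact div_ne_zero hy3 hy2⟩

theorem inv_mem_regularFunctions {U : Opens (JetQuotient n k)} (f : regularFunctions U) :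
    (fun v : nonvanishing f => (f.1 ⟨v.1, v.2.1⟩)⁻¹) ∈ regularFunctions (nonvanishing f) := by
  rintro x ⟨hx, hfx⟩
  obtain ⟨p, s, hs, hps⟩ := f.2 x hx
  rw [hps x hx hs] at hfx
  -- The fraction is `s / p` expanded by `s`, so that a nonzero denominator ensures `s ≠ 0`, where
  -- `f = p / s` is available.
  refine ⟨s * s, p * s, ?_, fun y hy hyy => ?_⟩
  · rw [map_mul]
    exact mul_ne_zero (left_ne_zero_of_mul hfx) hs
  · rw [map_mul] at hyy
    have hys := right_ne_zero_of_mul hyy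
    change (f.1 ⟨proj y, hy.1⟩)⁻¹ = _
    rw [hps y hy.1 hys, inv_div, map_mul, map_mul, mul_div_mul_right _ _ hys]

theorem coe_germ {U : Opens (JetQuotient n k)} {q : JetQuotient n k} (hq : q ∈ U)
    (f : regularFunctions U) :
    (germ U q hq f : Filter.Germ (nhds q) ℂ) = toGerm (nhds q) U (U.isOpen.mem_nhds hq) f.1 :=
  rfl

theorem isUnit_germ {U : Opens (JetQuotient n k)} {q : JetQuotient n k} (hq : q ∈ U)
    {f : regularFunctions U} (hf : f ∉ vanishingIdeal U q hq) : IsUnit (germ U q hq f) := by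
  have hqf : q ∈ nonvanishing f := ⟨hq, hf⟩
  refine IsUnit.of_mul_eq_one (germ _ q hqf ⟨_, inv_mem_regularFunctions f⟩) (Subtype.ext ?_)
  have hle : nonvanishing f ≤ U := fun v hv => hv.1
  have hr := toGerm_restrict (nhds q) (U.isOpen.mem_nhds hq)
    ((nonvanishing f).isOpen.mem_nhds hqf) hle f.1
  rw [Subalgebra.coe_mul, coe_germ, coe_germ, ← hr, ← map_mul, Subalgebra.coe_one,
    ← map_one (toGerm (nhds q) (nonvanishing f) ((nonvanishing f).isOpen.mem_nhds hqf))]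
  congr 1
  exact funext fun v => mul_inv_cancel₀ v.2.2

theorem germ_eq_iff {U : Opens (JetQuotient n k)} {q : JetQuotient n k} (hq : q ∈ U)
    (f g : regularFunctions U) : germ U q hq f = germ U q hq g ↔
      ∃ W : Opens (JetQuotient n k), q ∈ W ∧ ∀ u (hu : u ∈ U), u ∈ W → f.1 ⟨u, hu⟩ = g.1 ⟨u, hu⟩ := by
  rw [Subtype.ext_iff, coe_germ, coe_germ, toGerm_eq_iff]
  constructor
  · rintro ⟨s, hs, h⟩
    obtain ⟨W, hWs, hW, hqW⟩ := mem_nhds_iff.mp hs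
    exact ⟨⟨W, hW⟩, hqW, fun u hu huW => h u hu (hWs huW)⟩
  · rintro ⟨W, hqW, h⟩
    exact ⟨W, W.isOpen.mem_nhds hqW, h⟩

theorem ofPolynomial_notMem_vanishingIdeal {i : Fin n} {q : JetQuotient n k}
    (hq : q ∈ chart n k i) {p : MvPolynomial (Fin n × Fin k) ℂ} (hp : evalJet (slice i q) p ≠ 0) :
    ofPolynomial n k i p ∉ vanishingIdeal (chart n k i) q hq := fun h =>
  hp ((ofPolynomial_apply i p ⟨q, hq⟩).symm.trans h)

/-- A local expression `p / s` at the jet `slice i q`, restricted to the slice, has numerator and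
denominator that are regular on the whole chart. -/
theorem exists_germ_mul_eq {i : Fin n} {q : JetQuotient n k} (hq : q ∈ chart n k i)
    (z : stalk q) : ∃ a b : regularFunctions (chart n k i),
      b ∉ vanishingIdeal _ q hq ∧ z * germ _ q hq b = germ _ q hq a := by
  obtain ⟨V, hqV, g, hg, hgz⟩ := z.2
  have hsV : proj (slice i q) ∈ V := (proj_slice hq).symm ▸ hqV
  obtain ⟨p, s, hs, h⟩ := hg (slice i q) hsV
  have hb := ofPolynomial_notMem_vanishingIdeal hq hs
  refine ⟨ofPolynomial n k i p, ofPolynomial n k i s, hb, Subtype.ext ?_⟩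
  let W : Opens (JetQuotient n k) := V ⊓ nonvanishing (ofPolynomial n k i s)
  have hqW : q ∈ W := ⟨hqV, hq, hb⟩
  have hWmem : (W : Set (JetQuotient n k)) ∈ nhds q := W.isOpen.mem_nhds hqW
  have hWV : W ≤ V := inf_le_left
  have hWU : W ≤ chart n k i := fun v hv => hv.2.1
  rw [Subalgebra.coe_mul, ← hgz, coe_germ, coe_germ, ← toGerm_restrict (nhds q) _ hWmem hWV,
    ← toGerm_restrict (nhds q) _ hWmem hWU, ← toGerm_restrict (nhds q) _ hWmem hWU, ← map_mul]
  congr 1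
  funext v
  have hv := hWU v.2
  have hvs : evalJet (slice i v.1) s ≠ 0 := by
    have := v.2.2.2
    rwa [ofPolynomial_apply] at this
  have h1 := h (slice i v.1) ((proj_slice hv).symm ▸ hWV v.2) hvs
  simp only [proj_slice hv] at h1
  simp only [Pi.mul_apply, ofPolynomial_apply, h1, div_mul_cancel₀ _ hvs]

/-- The multiplier is a polynomial on the slice, nonzero at `q`, whose nonvanishing locus lies where
`f` and `g` agree. -/
theorem exists_mul_eq_of_germ_eq {i : Fin n} {q : JetQuotient n k} (hq : q ∈ chart n k i)
    {f g : regularFunctions (chart n k i)} (hfg : germ _ q hq f = germ _ q hq g) :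
    ∃ c ∉ vanishingIdeal _ q hq, c * f = c * g := by
  obtain ⟨W, hqW, hW⟩ := (germ_eq_iff hq f g).mp hfg
  obtain ⟨h, h1, h2⟩ := isOpen_iff_basicOpen.mp W.isOpen (slice i q) ((proj_slice hq).symm ▸ hqW)
  refine ⟨ofPolynomial n k i h, ofPolynomial_notMem_vanishingIdeal hq h1,
    Subtype.ext (funext fun u => ?_)⟩
  change (ofPolynomial n k i h).1 u * f.1 u = (ofPolynomial n k i h).1 u * g.1 u
  rw [ofPolynomial_apply]
  by_cases hu : evalJet (slice i u.1) h = 0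
  · rw [hu, zero_mul, zero_mul]
  · rw [hW u.1 u.2 (proj_slice u.2 ▸ h2 _ hu)]

end InvJet

theorem mainTheorem2 (n k : ℕ) (hk : 1 ≤ k) :
    Algebra.FiniteType ℂ (InvJet.Normalization.coordinateRing n k) ∧
    ∀ x : InvJet.Jet n k, x.IsRegular →
      ∃ (U : TopologicalSpace.Opens (InvJet.JetQuotient n k)) (hx : InvJet.proj x ∈ U),
        Algebra.FiniteType ℂ (InvJet.regularFunctions U) ∧
        letI : Algebra (InvJet.regularFunctions U) (InvJet.stalk (InvJet.proj x)) :=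
          (InvJet.germ U (InvJet.proj x) hx).toRingHom.toAlgebra
        IsLocalization.AtPrime (InvJet.stalk (InvJet.proj x))
          (InvJet.vanishingIdeal U (InvJet.proj x) hx) := by
  refine ⟨InvJet.finiteType_coordinateRing, fun x hx => ?_⟩
  obtain ⟨i, hi⟩ := hx.exists_mem_chart
  refine ⟨InvJet.chart n k i, hi, ?_, ?_⟩
  · exact Algebra.FiniteType.of_surjective (InvJet.ofPolynomial n k i)
      (InvJet.ofPolynomial_surjective i)
  · let _ : Algebra (InvJet.regularFunctions (InvJet.chart n k i)) (InvJet.stalk (InvJet.proj x)) :=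
      (InvJet.germ _ (InvJet.proj x) hi).toRingHom.toAlgebra
    refine (isLocalization_iff _ _).mpr ⟨fun y => InvJet.isUnit_germ hi y.2, fun z => ?_, fun hab => ?_⟩
    · obtain ⟨a, b, hb, h⟩ := InvJet.exists_germ_mul_eq hi z
      exact ⟨(a, ⟨b, hb⟩), h⟩
    · obtain ⟨c, hc, h⟩ := InvJet.exists_mul_eq_of_germ_eq hi hab
      exact ⟨⟨c, hc⟩, h⟩
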